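/- Consider a two-armed stochastic bandit: let $R_{\max}>0$, let $\mu$ be a finite measure on $[-R_{\max},R_{\max}]$, and for $a\in\{1,2\}$ let the reward of arm $a$ have probability density $P_a\ge 0$ with respect to $\mu$ and mean $r(a)=\int_{-R_{\max}}^{R_{\max}} x\,P_a(x)\,\mu(dx)$. Assume $r(1)>r(2)$. For $\theta\in\mathbb{R}^2$ let $\pi_\theta(a)=e^{\theta(a)}/(e^{\theta(1)}+e^{\theta(2)})$. The gradient bandit algorithm with constant learning rate $\eta>0$ starts from (possibly random) initial parameters $\theta_1\in\mathbb{R}^2$ and, at each time $t\ge 1$, conditionally on the past $(\theta_1,a_1,R_1,\dots,a_{t-1},R_{t-1})$, samples an action $a_t\sim\pi_{\theta_t}$ and then a reward $R_t$ with density $P_{a_t}$ with respect to $\mu$, and sets \[ \theta_{t+1}(a)=\begin{cases}\theta_t(a)+\eta\,(1-\pi_{\theta_t}(a))\,R_t & \text{if } a=a_t,\\ \theta_t(a)-\eta\,\pi_{\theta_t}(a)\,R_t & \text{if } a\ne a_t.\end{cases} \] Then, for every constant $\eta>0$, almost surely, as $t\to\infty$, \[ \pi_{\theta_t}(1)\to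 1,\qquad \theta_t(1)\to+\infty,\qquad \theta_t(2)\to-\infty . \] -/

import Mathlib

open MeasureTheory Filter Topology

/-- A `K`-armed stochastic bandit whose rewards lie in `[-Rmax, Rmax]`: the reward of arm `a` has
probability density `density a` with respect to a common finite measure `base` that is
carried by `[-Rmax, Rmax]`. -/
structure StochasticBandit (K : ℕ) where
  Rmax : ℝ
  Rmax_pos : 0 < Rmax
  base : Measure ℝ
  base_finite : IsFiniteMeasure base
  base_support : base (Set.Icc (-Rmax) Rmax)ᶜ = 0
  density : Fin K → ℝ → ℝ
  density_measurable : ∀ a, Measurable (density a)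
  density_nonneg : ∀ a x, 0 ≤ density a x
  density_lintegral : ∀ a, ∫⁻ x, ENNReal.ofReal (density a x) ∂base = 1

namespace StochasticBandit

/-- The reward distribution of arm `a`. -/
noncomputable def rewardLaw {K : ℕ} (B : StochasticBandit K) (a : Fin K) : Measure ℝ :=
  B.base.withDensity fun x => ENNReal.ofReal (B.density a x)

/-- The true mean reward of arm `a`. -/
noncomputable def meanReward {K : ℕ} (B : StochasticBandit K) (a : Fin K) : ℝ :=
  ∫ x in Set.Icc (-B.Rmax) B.Rmax, x * B.density a x ∂B.base

end StochasticBandit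

/-- The softmax policy with parameter vector `θ`. -/
noncomputable def softmaxPolicy {K : ℕ} (θ : Fin K → ℝ) (a : Fin K) : ℝ :=
  Real.exp (θ a) / ∑ b, Real.exp (θ b)

/-- The parameter vectors produced by the gradient bandit algorithm (without baselines) with
learning rate `η` and initial parameters `θ₁`, along the sequence of sampled actions `act` and
observed rewards `rew`. Time is counted from `0`: `gradientBanditParam η θ₁ act rew t` is the
parameter vector from which the action `act t` is drawn. -/
noncomputable def gradientBanditParam {K : ℕ} (η : ℝ) (θ₁ : Fin K → ℝ) (act : ℕ → Fin K)
    (rew : ℕ → ℝ) : ℕ → Fin K → ℝ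
  | 0 => θ₁
  | t + 1 => fun a =>
      let θ := gradientBanditParam η θ₁ act rew t
      if act t = a then θ a + η * (1 - softmaxPolicy θ a) * rew t
      else θ a - η * softmaxPolicy θ a * rew t

/-- The information available before the action at time `t` is drawn: the initial parameters
(which may be random) and all actions and observed rewards at times `s < t`. -/
@[reducible]
def banditHistory {Ω : Type*} {K : ℕ} (θ₁ : Ω → Fin K → ℝ) (act : ℕ → Ω → Fin K)
    (rew : ℕ → Ω → ℝ) (t : ℕ) : MeasurableSpace Ω :=
  MeasurableSpace.comap θ₁ inferInstance ⊔
    ⨆ s : Fin t, MeasurableSpace.comap (fun ω => (act s ω, rew s ω)) inferInstance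

/-- `(act, rew)` is the random sequence of actions and observed rewards of the gradient bandit
algorithm on the bandit `B` with learning rate `η` and initial parameters `θ₁`: conditionally on
the past, the action at time `t` is drawn from the current softmax policy and, given that it is
`a`, the observed reward is drawn from the reward distribution of `a`. -/
structure IsGradientBanditRun {Ω : Type*} [MeasurableSpace Ω] {K : ℕ} (P : Measure Ω)
    (B : StochasticBandit K) (η : ℝ) (θ₁ : Ω → Fin K → ℝ) (act : ℕ → Ω → Fin K)
    (rew : ℕ → Ω → ℝ) : Prop where
  measurable_init : Measurable θ₁
  measurable_act : ∀ t, Measurable (act t)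
  measurable_rew : ∀ t, Measurable (rew t)
  cond_law : ∀ (t : ℕ) (a : Fin K) (S : Set ℝ), MeasurableSet S →
    P[({ω | act t ω = a ∧ rew t ω ∈ S}.indicator fun _ => (1 : ℝ)) | banditHistory θ₁ act rew t]
      =ᵐ[P] fun ω =>
        softmaxPolicy (gradientBanditParam η (θ₁ ω) (act · ω) (rew · ω) t) a *
          (B.rewardLaw a).real S

/-!
The parameter of an arm `a` moves by `η` times an unbiased estimate `G` of the policy gradient
`π a * (r a - ∑ b, π b * r b)`. If `a` beats every other arm by at least `δ`, this drift is at
least `δ * π a * (1 - π a)`, while the conditional second moment of `G` is at most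
`R² * π a * (1 - π a)`: the noise vanishes at the same rate as the signal. Hence for a small
`κ > 0`, whatever `η` is, the conditional mean of `exp (-κ G)` is at most `1 - c * π a * (1 - π a)`
with `c > 0`, and `exp (-(κ / η) * (θ_t a - θ₁ a))` is a nonnegative supermartingale with summable
conditional decrease. So either `θ_t a → ∞`, or `θ_t a` converges and `π a * (1 - π a) → 0`. With
two arms the sum of the parameters is constant, so `π a` is a continuous function of `θ_t a` with
values in `(0, 1)`, which excludes the second case.
-/

section NonnegSupermartingale

variable {Ω : Type*} {m : MeasurableSpace Ω} {P : Measure Ω} [IsFiniteMeasure P]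
  {ℱ : Filtration ℕ m} {Y : ℕ → Ω → ℝ}

theorem ae_exists_tendsto_of_supermartingale_nonneg (hY : Supermartingale Y ℱ P)
    (hY0 : ∀ t, 0 ≤ᵐ[P] Y t) : ∀ᵐ ω ∂P, ∃ c, Tendsto (fun t => Y t ω) atTop (𝓝 c) := by
  have hbdd (t : ℕ) : eLpNorm ((-Y) t) 1 P ≤ ((∫ ω, Y 0 ω ∂P).toNNReal : ENNReal) := by
    have hmean : ∫ ω, Y t ω ∂P ≤ ∫ ω, Y 0 ω ∂P := by
      simpa using hY.setIntegral_le t.zero_le MeasurableSet.univ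
    rw [Pi.neg_apply, eLpNorm_neg, eLpNorm_one_eq_lintegral_enorm,
      ← ofReal_integral_norm_eq_lintegral_enorm (hY.integrable t),
      integral_congr_ae ((hY0 t).mono fun _ h => Real.norm_of_nonneg h)]
    exact ENNReal.ofReal_le_ofReal hmean
  filter_upwards [hY.neg.exists_ae_tendsto_of_bdd hbdd] with ω ⟨c, hc⟩
  exact ⟨-c, by simpa using hc.neg⟩

theorem ae_summable_sub_condExp_of_supermartingale_nonneg (hY : Supermartingale Y ℱ P)
    (hY0 : ∀ t, 0 ≤ᵐ[P] Y t) :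
    ∀ᵐ ω ∂P, Summable fun t => Y t ω - P[Y (t + 1) | ℱ t] ω := by
  set D : ℕ → Ω → ℝ := fun t => Y t - P[Y (t + 1) | ℱ t]
  have hDint (t : ℕ) : Integrable (D t) P := (hY.integrable t).sub integrable_condExp
  have hD0 (t : ℕ) : 0 ≤ᵐ[P] D t :=
    (hY.condExp_ae_le t.le_succ).mono fun ω h => sub_nonneg.2 h
  have hDmean (t : ℕ) : ∫ ω, D t ω ∂P = ∫ ω, Y t ω ∂P - ∫ ω, Y (t + 1) ω ∂P := by
    rw [← integral_condExp (f := Y (t + 1)) (ℱ.le t)]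
    exact integral_sub (hY.integrable t) integrable_condExp
  have hDsum : Summable fun t => ∫ ω, D t ω ∂P := by
    refine summable_of_sum_range_le (c := ∫ ω, Y 0 ω ∂P)
      (fun t => integral_nonneg_of_ae (hD0 t)) fun n => ?_
    simp only [hDmean, Finset.sum_range_sub']
    exact sub_le_self _ (integral_nonneg_of_ae (hY0 n))
  have hDnorm : ∑' t, eLpNorm (D t) 1 P ≠ ⊤ := by
    simp only [eLpNorm_one_eq_lintegral_enorm,
      ← ofReal_integral_norm_eq_lintegral_enorm (hDint _),
      integral_congr_ae ((hD0 _).mono fun _ h => Real.norm_of_nonneg h)]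
    exact hDsum.tsum_ofReal_ne_top
  exact (summable_norm_of_tsum_eLpNorm_ne_top le_rfl
    (fun t => (hDint t).aestronglyMeasurable) hDnorm).mono fun _ h => h.of_norm

end NonnegSupermartingale

section ExponentialSupermartingale

variable {Ω : Type*} {m₀ m : MeasurableSpace Ω} {P : Measure Ω} [IsFiniteMeasure P]

theorem integrable_exp_of_ae_abs_le {X : Ω → ℝ} (hX : AEStronglyMeasurable X P) {C : ℝ}
    (hC : ∀ᵐ ω ∂P, |X ω| ≤ C) :
    Integrable (fun ω => Real.exp (X ω)) P := by
  refine .of_bound (C := Real.exp C) (Real.continuous_exp.comp_aestronglyMeasurable hX) ?_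
  filter_upwards [hC] with ω h
  rw [Real.norm_of_nonneg (Real.exp_pos _).le]
  exact Real.exp_le_exp.2 ((le_abs_self _).trans h)

theorem integrable_sq_of_ae_abs_le {X : Ω → ℝ} (hX : AEStronglyMeasurable X P) {C : ℝ}
    (hC : ∀ᵐ ω ∂P, |X ω| ≤ C) : Integrable (fun ω => X ω ^ 2) P := by
  refine .of_bound (C := C ^ 2) (hX.pow 2) (hC.mono fun ω h => ?_)
  rw [norm_pow]
  exact pow_le_pow_left₀ (norm_nonneg _) h 2

theorem condExp_exp_le_one_add_add_sq (hm : m₀ ≤ m) {X : Ω → ℝ}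
    (hX : AEStronglyMeasurable X P) (hX1 : ∀ᵐ ω ∂P, |X ω| ≤ 1) :
    P[fun ω => Real.exp (X ω) | m₀] ≤ᵐ[P]
      fun ω => 1 + P[X | m₀] ω + P[fun ω => X ω ^ 2 | m₀] ω := by
  have hint : Integrable X P := .of_bound hX 1 hX1
  have hint2 : Integrable (fun ω => X ω ^ 2) P := integrable_sq_of_ae_abs_le hX hX1
  have hle : (fun ω => Real.exp (X ω)) ≤ᵐ[P] (fun _ => 1) + X + fun ω => X ω ^ 2 :=
    hX1.mono fun ω h => by
      simp only [Pi.add_apply]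
      linarith [(abs_le.1 (Real.abs_exp_sub_one_sub_id_le h)).2]
  have h1X : Integrable ((fun _ => 1) + X) P := (integrable_const 1).add hint
  filter_upwards [condExp_mono (m := m₀) (integrable_exp_of_ae_abs_le hX hX1) (h1X.add hint2) hle,
    condExp_add h1X hint2 m₀, condExp_add (integrable_const 1) hint m₀] with ω h h₁ h₂
  rwa [h₁, Pi.add_apply, h₂, Pi.add_apply, condExp_const hm] at h

theorem tendsto_atBot_or_nhds_of_tendsto_exp {ι : Type*} {l : Filter ι} {f : ι → ℝ} {c : ℝ}
    (hf : Tendsto (fun i => Real.exp (f i)) l (𝓝 c)) :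
    Tendsto f l atBot ∨ ∃ x, Tendsto f l (𝓝 x) := by
  rcases eq_or_ne c 0 with rfl | hc
  · exact .inl (Real.tendsto_exp_comp_nhds_zero.1 hf)
  · exact .inr ⟨Real.log c, by simpa only [Real.log_exp] using hf.log hc⟩

variable {ℱ : Filtration ℕ m} {ξ d : ℕ → Ω → ℝ} {C : ℕ → ℝ}

theorem stronglyAdapted_exp_sum_range (hξ : ∀ t, StronglyMeasurable[ℱ (t + 1)] (ξ t)) :
    StronglyAdapted ℱ fun t ω => Real.exp (∑ s ∈ Finset.range t, ξ s ω) := fun _ =>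
  Real.continuous_exp.comp_stronglyMeasurable <| Finset.stronglyMeasurable_fun_sum _ fun s hs =>
    (hξ s).mono (ℱ.mono (Finset.mem_range.1 hs))

theorem integrable_exp_sum_range (hξ : ∀ t, StronglyMeasurable[ℱ (t + 1)] (ξ t))
    (hξC : ∀ t, ∀ᵐ ω ∂P, |ξ t ω| ≤ C t) (t : ℕ) :
    Integrable (fun ω => Real.exp (∑ s ∈ Finset.range t, ξ s ω)) P := by
  refine integrable_exp_of_ae_abs_le (C := ∑ s ∈ Finset.range t, C s)
    (Finset.aestronglyMeasurable_fun_sum _ fun s _ =>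
      ((hξ s).mono (ℱ.le _)).aestronglyMeasurable) ?_
  filter_upwards [ae_all_iff.2 hξC] with ω h
  exact (Finset.abs_sum_le_sum_abs _ _).trans (Finset.sum_le_sum fun s _ => h s)

theorem condExp_exp_sum_range_succ_le (hξ : ∀ t, StronglyMeasurable[ℱ (t + 1)] (ξ t))
    (hξC : ∀ t, ∀ᵐ ω ∂P, |ξ t ω| ≤ C t) {t : ℕ} {q : Ω → ℝ}
    (hstep : P[fun ω => Real.exp (ξ t ω) | ℱ t] ≤ᵐ[P] q) :
    P[fun ω => Real.exp (∑ s ∈ Finset.range (t + 1), ξ s ω) | ℱ t] ≤ᵐ[P]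
      fun ω => Real.exp (∑ s ∈ Finset.range t, ξ s ω) * q ω := by
  have hsucc : (fun ω => Real.exp (∑ s ∈ Finset.range (t + 1), ξ s ω)) =
      (fun ω => Real.exp (∑ s ∈ Finset.range t, ξ s ω)) * fun ω => Real.exp (ξ t ω) := by
    ext ω
    rw [Finset.sum_range_succ, Real.exp_add, Pi.mul_apply]
  have hint := integrable_exp_sum_range hξ hξC (t + 1)
  rw [hsucc] at hint ⊢
  filter_upwards [hstep, condExp_mul_of_stronglyMeasurable_left
    (stronglyAdapted_exp_sum_range hξ t) hint (integrable_exp_of_ae_abs_le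
      ((hξ t).mono (ℱ.le _)).aestronglyMeasurable (hξC t))] with ω h hmul
  rw [hmul, Pi.mul_apply]
  exact mul_le_mul_of_nonneg_left h (Real.exp_pos _).le

theorem ae_tendsto_sum_atBot_or_of_condExp_exp_le
    (hξ : ∀ t, StronglyMeasurable[ℱ (t + 1)] (ξ t)) (hξC : ∀ t, ∀ᵐ ω ∂P, |ξ t ω| ≤ C t)
    (hd : ∀ t ω, 0 ≤ d t ω)
    (hstep : ∀ t, P[fun ω => Real.exp (ξ t ω) | ℱ t] ≤ᵐ[P] fun ω => 1 - d t ω) :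
    ∀ᵐ ω ∂P, Tendsto (fun t => ∑ s ∈ Finset.range t, ξ s ω) atTop atBot ∨
      (∃ l, Tendsto (fun t => ∑ s ∈ Finset.range t, ξ s ω) atTop (𝓝 l)) ∧
        Tendsto (fun t => d t ω) atTop (𝓝 0) := by
  set Y : ℕ → Ω → ℝ := fun t ω => Real.exp (∑ s ∈ Finset.range t, ξ s ω)
  have hYpos (t : ℕ) (ω : Ω) : 0 < Y t ω := Real.exp_pos _
  have hdrop (t : ℕ) : P[Y (t + 1) | ℱ t] ≤ᵐ[P] fun ω => Y t ω * (1 - d t ω) :=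
    condExp_exp_sum_range_succ_le hξ hξC (hstep t)
  have hY : Supermartingale Y ℱ P := by
    refine supermartingale_nat (stronglyAdapted_exp_sum_range hξ)
      (integrable_exp_sum_range hξ hξC) fun t => ?_
    filter_upwards [hdrop t] with ω h
    exact h.trans (mul_le_of_le_one_right (hYpos t ω).le (sub_le_self _ (hd t ω)))
  have hY0 (t : ℕ) : 0 ≤ᵐ[P] Y t := ae_of_all _ fun ω => (hYpos t ω).le
  filter_upwards [ae_all_iff.2 hdrop, ae_exists_tendsto_of_supermartingale_nonneg hY hY0,
    ae_summable_sub_condExp_of_supermartingale_nonneg hY hY0] with ω hω ⟨c, hc⟩ hsum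
  refine (tendsto_atBot_or_nhds_of_tendsto_exp hc).imp_right fun ⟨l, hl⟩ => ⟨⟨l, hl⟩, ?_⟩
  have hYd : Tendsto (fun t => Y t ω * d t ω) atTop (𝓝 0) :=
    squeeze_zero (fun t => mul_nonneg (hYpos t ω).le (hd t ω)) (fun t => by linarith [hω t])
      hsum.tendsto_atTop_zero
  have hYl : Tendsto (fun t => Y t ω) atTop (𝓝 (Real.exp l)) :=
    (Real.continuous_exp.tendsto l).comp hl
  have hlim := hYd.div hYl (Real.exp_pos l).ne'
  rw [zero_div] at hlim
  exact hlim.congr fun t => mul_div_cancel_left₀ _ (hYpos t ω).ne'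

end ExponentialSupermartingale

theorem gap_mul_one_sub_le_sub_sum_mul {ι : Type*} [Fintype ι] {w r : ι → ℝ} (hw : ∀ i, 0 ≤ w i)
    (hsum : ∑ i, w i = 1) {i : ι} {δ : ℝ} (hδ : ∀ j ≠ i, r j + δ ≤ r i) :
    δ * (1 - w i) ≤ r i - ∑ j, w j * r j := by
  classical
  calc δ * (1 - w i) = ∑ j, w j * (if j = i then 0 else δ) := by
        rw [← hsum, ← Finset.sum_erase_eq_sub (Finset.mem_univ i), Finset.mul_sum,
          ← Finset.sum_erase Finset.univ (a := i) (by simp)]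
        exact Finset.sum_congr rfl fun j hj => by
          rw [if_neg (Finset.ne_of_mem_erase hj), mul_comm]
    _ ≤ ∑ j, w j * (r i - r j) := Finset.sum_le_sum fun j _ => by
        refine mul_le_mul_of_nonneg_left ?_ (hw j)
        split_ifs with h
        · simp [h]
        · linarith [hδ j h]
    _ = r i - ∑ j, w j * r j := by
        simp only [mul_sub, Finset.sum_sub_distrib, ← Finset.sum_mul, hsum, one_mul]

theorem exists_pos_mul_le_one_and_mul_sq_lt (R : ℝ) {δ : ℝ} (hδ : 0 < δ) :
    ∃ κ > 0, κ * R ≤ 1 ∧ κ * R ^ 2 < δ := by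
  have hsmall (c : ℝ) {ε : ℝ} (hε : 0 < ε) : ∀ᶠ κ in 𝓝[>] (0 : ℝ), κ * c < ε :=
    ((continuous_mul_const c).tendsto' 0 0 (zero_mul c)).mono_left nhdsWithin_le_nhds
      |>.eventually_lt_const hε
  obtain ⟨κ, ⟨h₁, h₂⟩, hκ⟩ := (((hsmall R one_pos).and (hsmall (R ^ 2) hδ)).and
    self_mem_nhdsWithin).exists
  exact ⟨κ, hκ, h₁.le, h₂⟩

namespace StochasticBandit

variable {K : ℕ} (B : StochasticBandit K) (a : Fin K)

instance isProbabilityMeasure_rewardLaw : IsProbabilityMeasure (B.rewardLaw a) :=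
  ⟨by rw [rewardLaw, withDensity_apply _ MeasurableSet.univ, Measure.restrict_univ,
    B.density_lintegral]⟩

theorem rewardLaw_compl_Icc : B.rewardLaw a (Set.Icc (-B.Rmax) B.Rmax)ᶜ = 0 :=
  withDensity_absolutelyContinuous _ _ B.base_support

theorem integrable_id_rewardLaw : Integrable (fun x : ℝ => x) (B.rewardLaw a) := by
  refine Integrable.of_bound (C := B.Rmax) measurable_id.aestronglyMeasurable ?_
  have h : ∀ᵐ x ∂B.rewardLaw a, x ∈ Set.Icc (-B.Rmax) B.Rmax := B.rewardLaw_compl_Icc a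
  filter_upwards [h] with x hx
  exact abs_le.2 hx

theorem integral_id_rewardLaw : ∫ x, x ∂B.rewardLaw a = B.meanReward a := by
  have h : B.base.restrict (Set.Icc (-B.Rmax) B.Rmax) = B.base :=
    Measure.restrict_eq_self_of_ae_mem B.base_support
  rw [meanReward, h, rewardLaw, integral_withDensity_eq_integral_toReal_smul
    (B.density_measurable a).ennreal_ofReal (ae_of_all _ fun _ => ENNReal.ofReal_lt_top)]
  refine integral_congr_ae (ae_of_all _ fun x => ?_)
  simp [ENNReal.toReal_ofReal (B.density_nonneg a x), mul_comm]

end StochasticBandit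

section SoftmaxPolicy

variable {K : ℕ}

theorem measurable_softmaxPolicy (a : Fin K) :
    Measurable fun θ : Fin K → ℝ => softmaxPolicy θ a := by
  unfold softmaxPolicy
  fun_prop

variable (θ : Fin K → ℝ)

theorem softmaxPolicy_nonneg (a : Fin K) : 0 ≤ softmaxPolicy θ a := by
  unfold softmaxPolicy
  positivity

theorem sum_softmaxPolicy [NeZero K] : ∑ a, softmaxPolicy θ a = 1 := by
  simp only [softmaxPolicy, ← Finset.sum_div]
  exact div_self (Finset.sum_pos (fun _ _ => Real.exp_pos _) Finset.univ_nonempty).ne'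

theorem softmaxPolicy_le_one (a : Fin K) : softmaxPolicy θ a ≤ 1 :=
  have : NeZero K := ⟨a.pos.ne'⟩
  sum_softmaxPolicy θ ▸
    Finset.single_le_sum (fun b _ => softmaxPolicy_nonneg θ b) (Finset.mem_univ a)

theorem norm_softmaxPolicy_le_one (a : Fin K) : ‖softmaxPolicy θ a‖ ≤ 1 := by
  rw [Real.norm_of_nonneg (softmaxPolicy_nonneg θ a)]
  exact softmaxPolicy_le_one θ a

theorem softmaxPolicy_zero_eq_sigmoid (θ : Fin 2 → ℝ) :
    softmaxPolicy θ 0 = Real.sigmoid (θ 0 - θ 1) := by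
  rw [softmaxPolicy, Fin.sum_univ_two, Real.sigmoid_def, neg_sub, Real.exp_sub]
  field_simp

/-- The estimate of the gradient in `θ` of the expected reward `∑ b, softmaxPolicy θ b * r b` from
one sampled action `b` and its observed reward `x`; see
`IsGradientBanditRun.condExp_policyGradientEstimate`. -/
noncomputable def policyGradientEstimate (θ : Fin K → ℝ) (b : Fin K) (x : ℝ) (a : Fin K) : ℝ :=
  ((if b = a then 1 else 0) - softmaxPolicy θ a) * x

theorem measurable_policyGradientEstimate (a : Fin K) :
    Measurable fun p : (Fin K → ℝ) × Fin K × ℝ => policyGradientEstimate p.1 p.2.1 p.2.2 a :=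
  ((Measurable.ite (measurable_snd.fst (measurableSet_singleton a)) measurable_const
    measurable_const).sub ((measurable_softmaxPolicy a).comp measurable_fst)).mul measurable_snd.snd

theorem sum_policyGradientEstimate (b : Fin K) (x : ℝ) :
    ∑ a, policyGradientEstimate θ b x a = 0 := by
  have : NeZero K := ⟨b.pos.ne'⟩
  simp [policyGradientEstimate, ← Finset.sum_mul, Finset.sum_sub_distrib, sum_softmaxPolicy]

theorem abs_policyGradientEstimate_le (b : Fin K) (x : ℝ) (a : Fin K) :
    |policyGradientEstimate θ b x a| ≤ |x| := by
  rw [policyGradientEstimate, abs_mul]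
  refine mul_le_of_le_one_left (abs_nonneg x) (abs_le.2 ?_)
  have h0 := softmaxPolicy_nonneg θ a
  have h1 := softmaxPolicy_le_one θ a
  split_ifs <;> constructor <;> linarith

-- The indicator of `b = a` enters linearly, as only its conditional mean will be known.
theorem sq_policyGradientEstimate_le {x R : ℝ} (hx : |x| ≤ R) (b a : Fin K) :
    policyGradientEstimate θ b x a ^ 2 ≤
      R ^ 2 * ((if b = a then 1 else 0) * (1 - 2 * softmaxPolicy θ a) + softmaxPolicy θ a ^ 2) := by
  have hsq : x ^ 2 ≤ R ^ 2 := sq_le_sq' (abs_le.1 hx).1 (abs_le.1 hx).2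
  rw [policyGradientEstimate, mul_pow, mul_comm]
  refine (mul_le_mul_of_nonneg_right hsq (sq_nonneg _)).trans_eq ?_
  split_ifs <;> ring

end SoftmaxPolicy

section Trajectory

variable {K : ℕ} (η : ℝ) (θ₁ : Fin K → ℝ) (act : ℕ → Fin K) (rew : ℕ → ℝ)

theorem gradientBanditParam_succ (t : ℕ) (a : Fin K) :
    gradientBanditParam η θ₁ act rew (t + 1) a = gradientBanditParam η θ₁ act rew t a +
      η * policyGradientEstimate (gradientBanditParam η θ₁ act rew t) (act t) (rew t) a := by
  simp only [gradientBanditParam, policyGradientEstimate]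
  split_ifs <;> ring

theorem gradientBanditParam_eq_add_sum (t : ℕ) (a : Fin K) :
    gradientBanditParam η θ₁ act rew t a = θ₁ a + η * ∑ s ∈ Finset.range t,
      policyGradientEstimate (gradientBanditParam η θ₁ act rew s) (act s) (rew s) a := by
  induction t with
  | zero => simp [gradientBanditParam]
  | succ t ih => rw [gradientBanditParam_succ, ih, Finset.sum_range_succ, mul_add, add_assoc]

theorem sum_gradientBanditParam (t : ℕ) :
    ∑ a, gradientBanditParam η θ₁ act rew t a = ∑ a, θ₁ a := by
  simp only [gradientBanditParam_eq_add_sum, Finset.sum_add_distrib, ← Finset.mul_sum]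
  rw [Finset.sum_comm]
  simp [sum_policyGradientEstimate]

end Trajectory

section GradientBanditRun

variable {Ω : Type*} {K : ℕ} (η : ℝ) (θ₁ : Ω → Fin K → ℝ) (act : ℕ → Ω → Fin K)
  (rew : ℕ → Ω → ℝ)

local notation "Θ[" t "," ω "]" => gradientBanditParam η (θ₁ ω) (act · ω) (rew · ω) t

theorem banditHistory_mono : Monotone (banditHistory θ₁ act rew) := by
  intro s t hst
  refine sup_le_sup_left (iSup_le fun i => ?_) _
  exact le_iSup (fun j : Fin t => MeasurableSpace.comap (fun ω => (act j ω, rew j ω)) inferInstance)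
    (Fin.castLE hst i)

theorem measurable_init_banditHistory (t : ℕ) : Measurable[banditHistory θ₁ act rew t] θ₁ :=
  measurable_iff_comap_le.2 le_sup_left

theorem measurable_act_rew_banditHistory {s t : ℕ} (hst : s < t) :
    Measurable[banditHistory θ₁ act rew t] fun ω => (act s ω, rew s ω) :=
  measurable_iff_comap_le.2 (le_sup_of_le_right (le_iSup_of_le ⟨s, hst⟩ le_rfl))

theorem measurable_gradientBanditParam (t : ℕ) :
    Measurable[banditHistory θ₁ act rew t] fun ω => Θ[t, ω] := by
  induction t with
  | zero => exact measurable_init_banditHistory θ₁ act rew 0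
  | succ t ih =>
    let _ : MeasurableSpace Ω := banditHistory θ₁ act rew (t + 1)
    have hθ : Measurable fun ω => Θ[t, ω] :=
      ih.mono (banditHistory_mono θ₁ act rew t.le_succ) le_rfl
    have hpair : Measurable fun ω => (act t ω, rew t ω) :=
      measurable_act_rew_banditHistory θ₁ act rew t.lt_succ_self
    refine measurable_pi_lambda _ fun a => ?_
    simp only [gradientBanditParam_succ]
    exact ((measurable_pi_apply a).comp hθ).add
      (((measurable_policyGradientEstimate a).comp (hθ.prodMk hpair)).const_mul η)

theorem stronglyMeasurable_softmaxPolicy_banditHistory (t : ℕ) (a : Fin K) :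
    StronglyMeasurable[banditHistory θ₁ act rew t] fun ω => softmaxPolicy Θ[t, ω] a :=
  ((measurable_softmaxPolicy a).comp
    (measurable_gradientBanditParam η θ₁ act rew t)).stronglyMeasurable

theorem stronglyMeasurable_policyGradientEstimate_banditHistory (t : ℕ) (a : Fin K) :
    StronglyMeasurable[banditHistory θ₁ act rew (t + 1)]
      fun ω => policyGradientEstimate Θ[t, ω] (act t ω) (rew t ω) a :=
  ((measurable_policyGradientEstimate a).comp
    (((measurable_gradientBanditParam η θ₁ act rew t).mono
      (banditHistory_mono θ₁ act rew t.le_succ) le_rfl).prodMk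
        (measurable_act_rew_banditHistory θ₁ act rew t.lt_succ_self))).stronglyMeasurable

variable {m : MeasurableSpace Ω} {P : Measure Ω} {B : StochasticBandit K}
variable {η θ₁ act rew}

namespace IsGradientBanditRun

theorem banditHistory_le (hrun : IsGradientBanditRun P B η θ₁ act rew) (t : ℕ) :
    banditHistory θ₁ act rew t ≤ m :=
  sup_le hrun.measurable_init.comap_le (iSup_le fun s =>
    ((hrun.measurable_act s).prodMk (hrun.measurable_rew s)).comap_le)

/-- The filtration of the information available to the algorithm: its `t`-th σ-algebra is that of
the past before the action at time `t` is drawn. -/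
def filtration (hrun : IsGradientBanditRun P B η θ₁ act rew) : Filtration ℕ m where
  seq := banditHistory θ₁ act rew
  mono' := banditHistory_mono θ₁ act rew
  le' := hrun.banditHistory_le

theorem condExp_indicator_act (hrun : IsGradientBanditRun P B η θ₁ act rew) (t : ℕ) (a : Fin K) :
    P[{ω | act t ω = a}.indicator (fun _ => (1 : ℝ)) | banditHistory θ₁ act rew t]
      =ᵐ[P] fun ω => softmaxPolicy Θ[t, ω] a := by
  simpa using hrun.cond_law t a Set.univ MeasurableSet.univ

variable [IsFiniteMeasure P]

theorem integrable_softmaxPolicy (hrun : IsGradientBanditRun P B η θ₁ act rew) (t : ℕ)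
    (a : Fin K) : Integrable (fun ω => softmaxPolicy Θ[t, ω] a) P :=
  .of_bound (C := 1) ((stronglyMeasurable_softmaxPolicy_banditHistory η θ₁ act rew t a).mono
    (hrun.banditHistory_le t)).aestronglyMeasurable
    (ae_of_all _ fun _ => norm_softmaxPolicy_le_one _ _)

theorem map_rew_restrict (hrun : IsGradientBanditRun P B η θ₁ act rew) (t : ℕ) (a : Fin K)
    {A : Set Ω} (hA : MeasurableSet[banditHistory θ₁ act rew t] A) :
    (P.restrict ({ω | act t ω = a} ∩ A)).map (rew t)
      = ENNReal.ofReal (∫ ω in A, softmaxPolicy Θ[t, ω] a ∂P) • B.rewardLaw a := by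
  have hact : MeasurableSet {ω | act t ω = a} := hrun.measurable_act t (measurableSet_singleton a)
  have hle := hrun.banditHistory_le t
  ext S hS
  have hE : MeasurableSet {ω | act t ω = a ∧ rew t ω ∈ S} := hact.inter (hrun.measurable_rew t hS)
  have hint := setIntegral_condExp hle
    ((integrable_const (1 : ℝ)).indicator hE : Integrable _ P) hA
  rw [setIntegral_congr_ae (hle A hA) ((hrun.cond_law t a S hS).mono fun ω h _ => h),
    integral_mul_const, integral_indicator_const _ hE, measureReal_restrict_apply hE,
    smul_eq_mul, mul_one] at hint
  rw [Measure.map_apply (hrun.measurable_rew t) hS,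
    Measure.restrict_apply (hrun.measurable_rew t hS), Measure.smul_apply, smul_eq_mul,
    ← ofReal_measureReal (μ := B.rewardLaw a), ← ENNReal.ofReal_mul
      (integral_nonneg fun ω => softmaxPolicy_nonneg _ _), hint, ofReal_measureReal]
  congr 1
  ext ω
  simp only [Set.mem_inter_iff, Set.mem_preimage, Set.mem_ofPred_eq]
  tauto

theorem integrable_indicator_rew (hrun : IsGradientBanditRun P B η θ₁ act rew) (t : ℕ)
    (a : Fin K) {f : ℝ → ℝ} (hf : Integrable f (B.rewardLaw a)) :
    Integrable ({ω | act t ω = a}.indicator fun ω => f (rew t ω)) P := by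
  have hact : MeasurableSet {ω | act t ω = a} := hrun.measurable_act t (measurableSet_singleton a)
  have hmap := hrun.map_rew_restrict t a MeasurableSet.univ
  rw [Set.inter_univ] at hmap
  rw [integrable_indicator_iff hact, IntegrableOn]
  refine Integrable.comp_measurable (g := f) ?_ (hrun.measurable_rew t)
  rw [hmap]
  exact hf.smul_measure ENNReal.ofReal_ne_top

theorem condExp_indicator_rew (hrun : IsGradientBanditRun P B η θ₁ act rew) (t : ℕ)
    (a : Fin K) {f : ℝ → ℝ} (hf : Integrable f (B.rewardLaw a)) :
    P[{ω | act t ω = a}.indicator (fun ω => f (rew t ω)) | banditHistory θ₁ act rew t]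
      =ᵐ[P] fun ω => softmaxPolicy Θ[t, ω] a * ∫ x, f x ∂B.rewardLaw a := by
  have hact : MeasurableSet {ω | act t ω = a} := hrun.measurable_act t (measurableSet_singleton a)
  have hle := hrun.banditHistory_le t
  refine (ae_eq_condExp_of_forall_setIntegral_eq hle (hrun.integrable_indicator_rew t a hf)
    (fun A _ _ => ((hrun.integrable_softmaxPolicy t a).mul_const _).integrableOn)
    (fun A hA _ => ?_) ?_).symm
  · have hmap := hrun.map_rew_restrict t a hA
    rw [integral_mul_const, setIntegral_indicator hact, Set.inter_comm A,
      ← integral_map (hrun.measurable_rew t).aemeasurable (f := f), hmap, integral_smul_measure,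
      ENNReal.toReal_ofReal (integral_nonneg fun ω => softmaxPolicy_nonneg _ _), smul_eq_mul]
    rw [hmap]
    exact (hf.smul_measure ENNReal.ofReal_ne_top).aestronglyMeasurable
  · exact ((stronglyMeasurable_softmaxPolicy_banditHistory η θ₁ act rew t a).mul_const
      _).aestronglyMeasurable

theorem ae_abs_rew_le (hrun : IsGradientBanditRun P B η θ₁ act rew) :
    ∀ᵐ ω ∂P, ∀ t, |rew t ω| ≤ B.Rmax := by
  refine ae_all_iff.2 fun t => ?_
  have h : ∀ a, ∀ᵐ ω ∂P, act t ω = a → rew t ω ∈ Set.Icc (-B.Rmax) B.Rmax := fun a => by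
    have hact : MeasurableSet {ω | act t ω = a} :=
      hrun.measurable_act t (measurableSet_singleton a)
    have hmap := hrun.map_rew_restrict t a MeasurableSet.univ
    rw [Set.inter_univ] at hmap
    refine (ae_restrict_iff' hact).1 (ae_of_ae_map (hrun.measurable_rew t).aemeasurable
      (p := fun x => x ∈ Set.Icc (-B.Rmax) B.Rmax) ?_)
    rw [hmap]
    exact Measure.ae_smul_measure (B.rewardLaw_compl_Icc a) _
  filter_upwards [ae_all_iff.2 h] with ω hω
  exact abs_le.2 (hω _ rfl)

theorem integrable_rew (hrun : IsGradientBanditRun P B η θ₁ act rew) (t : ℕ) :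
    Integrable (rew t) P :=
  .of_bound (C := B.Rmax) (hrun.measurable_rew t).aestronglyMeasurable
    (hrun.ae_abs_rew_le.mono fun _ h => h t)

theorem condExp_rew (hrun : IsGradientBanditRun P B η θ₁ act rew) (t : ℕ) :
    P[rew t | banditHistory θ₁ act rew t]
      =ᵐ[P] fun ω => ∑ b, softmaxPolicy Θ[t, ω] b * B.meanReward b := by
  have hsplit : rew t = ∑ b, {ω | act t ω = b}.indicator fun ω => rew t ω := by
    ext ω
    simp [Set.indicator_apply]
  have hb (b : Fin K) := hrun.condExp_indicator_rew t b (B.integrable_id_rewardLaw b)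
  have hsum := condExp_finsetSum (s := Finset.univ) (fun b _ => hrun.integrable_indicator_rew t b
    (B.integrable_id_rewardLaw b)) (banditHistory θ₁ act rew t)
  rw [← hsplit] at hsum
  filter_upwards [hsum, ae_all_iff.2 hb] with ω h₁ h₂
  simp only [h₁, Finset.sum_apply, h₂, B.integral_id_rewardLaw]

theorem ae_abs_policyGradientEstimate_le (hrun : IsGradientBanditRun P B η θ₁ act rew) (t : ℕ)
    (a : Fin K) :
    ∀ᵐ ω ∂P, |policyGradientEstimate Θ[t, ω] (act t ω) (rew t ω) a| ≤ B.Rmax :=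
  hrun.ae_abs_rew_le.mono fun _ h => (abs_policyGradientEstimate_le _ _ _ _).trans (h t)

theorem integrable_sq_policyGradientEstimate (hrun : IsGradientBanditRun P B η θ₁ act rew) (t : ℕ)
    (a : Fin K) :
    Integrable (fun ω => policyGradientEstimate Θ[t, ω] (act t ω) (rew t ω) a ^ 2) P :=
  integrable_sq_of_ae_abs_le
    ((stronglyMeasurable_policyGradientEstimate_banditHistory η θ₁ act rew t a).mono
      (hrun.banditHistory_le (t + 1))).aestronglyMeasurable
    (hrun.ae_abs_policyGradientEstimate_le t a)

theorem condExp_policyGradientEstimate (hrun : IsGradientBanditRun P B η θ₁ act rew) (t : ℕ)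
    (a : Fin K) :
    P[fun ω => policyGradientEstimate Θ[t, ω] (act t ω) (rew t ω) a | banditHistory θ₁ act rew t]
      =ᵐ[P] fun ω => softmaxPolicy Θ[t, ω] a *
        (B.meanReward a - ∑ b, softmaxPolicy Θ[t, ω] b * B.meanReward b) := by
  set p : Ω → ℝ := fun ω => softmaxPolicy Θ[t, ω] a
  set rewA : Ω → ℝ := {ω | act t ω = a}.indicator fun ω => rew t ω
  have hsplit : (fun ω => policyGradientEstimate Θ[t, ω] (act t ω) (rew t ω) a) =
      rewA - p * rew t := by
    ext ω
    simp [policyGradientEstimate, rewA, p, Set.indicator_apply, sub_mul]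
  have hp : StronglyMeasurable[banditHistory θ₁ act rew t] p :=
    stronglyMeasurable_softmaxPolicy_banditHistory η θ₁ act rew t a
  have hrewA : Integrable rewA P :=
    hrun.integrable_indicator_rew t a (B.integrable_id_rewardLaw a)
  have hprew : Integrable (p * rew t) P :=
    (hrun.integrable_rew t).bdd_mul (hp.mono (hrun.banditHistory_le t)).aestronglyMeasurable
      (ae_of_all _ fun _ => norm_softmaxPolicy_le_one _ _)
  rw [hsplit]
  filter_upwards [condExp_sub hrewA hprew (banditHistory θ₁ act rew t),
    condExp_mul_of_stronglyMeasurable_left hp hprew (hrun.integrable_rew t),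
    hrun.condExp_indicator_rew t a (B.integrable_id_rewardLaw a), hrun.condExp_rew t]
    with ω h h₁ h₂ h₃
  rw [h, Pi.sub_apply, h₁, h₂, Pi.mul_apply, h₃, B.integral_id_rewardLaw, mul_sub]

theorem condExp_sq_policyGradientEstimate_le (hrun : IsGradientBanditRun P B η θ₁ act rew) (t : ℕ)
    (a : Fin K) :
    P[fun ω => policyGradientEstimate Θ[t, ω] (act t ω) (rew t ω) a ^ 2
        | banditHistory θ₁ act rew t]
      ≤ᵐ[P] fun ω => B.Rmax ^ 2 * (softmaxPolicy Θ[t, ω] a * (1 - softmaxPolicy Θ[t, ω] a)) := by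
  have hle := hrun.banditHistory_le t
  set p : Ω → ℝ := fun ω => softmaxPolicy Θ[t, ω] a
  set drawn : Ω → ℝ := {ω | act t ω = a}.indicator fun _ => 1
  set G : Ω → ℝ := fun ω => policyGradientEstimate Θ[t, ω] (act t ω) (rew t ω) a
  set w : Ω → ℝ := fun ω => 1 - 2 * p ω
  have hp : StronglyMeasurable[banditHistory θ₁ act rew t] p :=
    stronglyMeasurable_softmaxPolicy_banditHistory η θ₁ act rew t a
  have hw : StronglyMeasurable[banditHistory θ₁ act rew t] w :=
    stronglyMeasurable_const.sub (hp.const_mul 2)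
  have hw1 : ∀ᵐ ω ∂P, ‖w ω‖ ≤ 1 := ae_of_all _ fun ω => by
    have h0 := softmaxPolicy_nonneg Θ[t, ω] a
    have h1 := softmaxPolicy_le_one Θ[t, ω] a
    exact abs_le.2 ⟨by linarith, by linarith⟩
  have hdrawn : Integrable drawn P :=
    (integrable_const 1).indicator (hrun.measurable_act t (measurableSet_singleton a))
  have hwdrawn : Integrable (w * drawn) P := hdrawn.bdd_mul (hw.mono hle).aestronglyMeasurable hw1
  have hp2 : Integrable (p ^ 2) P := integrable_sq_of_ae_abs_le (hp.mono hle).aestronglyMeasurable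
    (ae_of_all _ fun _ => norm_softmaxPolicy_le_one _ _)
  have hGle : (fun ω => G ω ^ 2) ≤ᵐ[P] B.Rmax ^ 2 • (w * drawn + p ^ 2) := by
    filter_upwards [hrun.ae_abs_rew_le] with ω h
    refine (sq_policyGradientEstimate_le _ (h t) _ _).trans_eq ?_
    simp [w, p, drawn, Set.indicator_apply, mul_comm]
  filter_upwards [condExp_mono (m := banditHistory θ₁ act rew t)
      (hrun.integrable_sq_policyGradientEstimate t a) ((hwdrawn.add hp2).smul (B.Rmax ^ 2)) hGle,
    condExp_smul (B.Rmax ^ 2) (w * drawn + p ^ 2) (banditHistory θ₁ act rew t) (μ := P),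
    condExp_add hwdrawn hp2 (banditHistory θ₁ act rew t),
    condExp_stronglyMeasurable_mul_of_bound hle hw hdrawn 1 hw1, hrun.condExp_indicator_act t a]
    with ω h h₁ h₂ h₃ h₄
  rw [h₁, Pi.smul_apply, h₂, Pi.add_apply, h₃, Pi.mul_apply, h₄,
    condExp_of_stronglyMeasurable hle (hp.pow 2) hp2] at h
  refine h.trans_eq ?_
  simp only [w, p, smul_eq_mul, Pi.pow_apply]
  ring

theorem condExp_exp_neg_mul_policyGradientEstimate_le
    (hrun : IsGradientBanditRun P B η θ₁ act rew) (t : ℕ) {a : Fin K} {δ κ : ℝ}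
    (hδ : ∀ b ≠ a, B.meanReward b + δ ≤ B.meanReward a) (hκ : 0 ≤ κ) (hκR : κ * B.Rmax ≤ 1) :
    P[fun ω => Real.exp (-κ * policyGradientEstimate Θ[t, ω] (act t ω) (rew t ω) a)
        | banditHistory θ₁ act rew t]
      ≤ᵐ[P] fun ω => 1 - κ * (δ - κ * B.Rmax ^ 2) *
        (softmaxPolicy Θ[t, ω] a * (1 - softmaxPolicy Θ[t, ω] a)) := by
  have hle := hrun.banditHistory_le t
  have : NeZero K := ⟨a.pos.ne'⟩
  set G : Ω → ℝ := fun ω => policyGradientEstimate Θ[t, ω] (act t ω) (rew t ω) a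
  have hG : AEStronglyMeasurable (-κ • G) P :=
    ((stronglyMeasurable_policyGradientEstimate_banditHistory η θ₁ act rew t a).mono
      (hrun.banditHistory_le (t + 1))).aestronglyMeasurable.const_smul _
  have hG1 : ∀ᵐ ω ∂P, |(-κ • G) ω| ≤ 1 := by
    filter_upwards [hrun.ae_abs_policyGradientEstimate_le t a] with ω h
    rw [Pi.smul_apply, smul_eq_mul, abs_mul, abs_neg, abs_of_nonneg hκ]
    exact (mul_le_mul_of_nonneg_left h hκ).trans hκR
  have hsq : (fun ω => (-κ • G) ω ^ 2) = κ ^ 2 • fun ω => G ω ^ 2 := by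
    ext ω
    simp [mul_pow]
  have hexp := condExp_exp_le_one_add_add_sq hle hG hG1
  rw [hsq] at hexp
  filter_upwards [hexp, condExp_smul (-κ) G (banditHistory θ₁ act rew t) (μ := P),
    condExp_smul (κ ^ 2) (fun ω => G ω ^ 2) (banditHistory θ₁ act rew t) (μ := P),
    hrun.condExp_policyGradientEstimate t a, hrun.condExp_sq_policyGradientEstimate_le t a]
    with ω h h₁ h₂ hmean hsecond
  have hgap := gap_mul_one_sub_le_sub_sum_mul (softmaxPolicy_nonneg Θ[t, ω])
    (sum_softmaxPolicy Θ[t, ω]) hδ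
  rw [h₁, h₂, Pi.smul_apply, Pi.smul_apply, hmean, smul_eq_mul, smul_eq_mul] at h
  have hdrift := mul_le_mul_of_nonneg_left hgap (mul_nonneg hκ (softmaxPolicy_nonneg Θ[t, ω] a))
  have hnoise := mul_le_mul_of_nonneg_left hsecond (sq_nonneg κ)
  simp only [Pi.smul_apply, smul_eq_mul] at h
  linarith

theorem ae_tendsto_gradientBanditParam_atTop_or (hrun : IsGradientBanditRun P B η θ₁ act rew)
    (hη : 0 < η) {a : Fin K} {δ : ℝ} (hδ0 : 0 < δ)
    (hδ : ∀ b ≠ a, B.meanReward b + δ ≤ B.meanReward a) :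
    ∀ᵐ ω ∂P, Tendsto (fun t => Θ[t, ω] a) atTop atTop ∨
      (∃ l, Tendsto (fun t => Θ[t, ω] a) atTop (𝓝 l)) ∧
        Tendsto (fun t => softmaxPolicy Θ[t, ω] a * (1 - softmaxPolicy Θ[t, ω] a)) atTop
          (𝓝 0) := by
  obtain ⟨κ, hκ, hκR, hκδ⟩ := exists_pos_mul_le_one_and_mul_sq_lt B.Rmax hδ0
  have hc : 0 < κ * (δ - κ * B.Rmax ^ 2) := mul_pos hκ (sub_pos.2 hκδ)
  have hmain := ae_tendsto_sum_atBot_or_of_condExp_exp_le (ℱ := hrun.filtration)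
    (ξ := fun t ω => -κ * policyGradientEstimate Θ[t, ω] (act t ω) (rew t ω) a)
    (fun t => (stronglyMeasurable_policyGradientEstimate_banditHistory η θ₁ act rew t
      a).const_mul (-κ))
    (fun t => (hrun.ae_abs_policyGradientEstimate_le t a).mono fun ω h => by
      rw [abs_mul]
      exact mul_le_mul_of_nonneg_left h (abs_nonneg _))
    (fun t ω => mul_nonneg hc.le (mul_nonneg (softmaxPolicy_nonneg Θ[t, ω] a)
      (sub_nonneg.2 (softmaxPolicy_le_one Θ[t, ω] a))))
    (fun t => hrun.condExp_exp_neg_mul_policyGradientEstimate_le t hδ hκ.le hκR)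
  filter_upwards [hmain] with ω hω
  have hparam (t : ℕ) : θ₁ ω a + -(η / κ) * ∑ s ∈ Finset.range t,
      -κ * policyGradientEstimate Θ[s, ω] (act s ω) (rew s ω) a = Θ[t, ω] a := by
    rw [gradientBanditParam_eq_add_sum, ← Finset.mul_sum]
    field_simp
  refine hω.imp (fun h => ?_) fun ⟨⟨l, hl⟩, h⟩ => ⟨⟨θ₁ ω a + -(η / κ) * l, ?_⟩, ?_⟩
  · exact (tendsto_atTop_add_const_left _ _
      (h.const_mul_atBot_of_neg (neg_neg_of_pos (div_pos hη hκ)))).congr hparam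
  · exact ((hl.const_mul _).const_add _).congr hparam
  · have hlim := h.div_const (κ * (δ - κ * B.Rmax ^ 2))
    rw [zero_div] at hlim
    exact hlim.congr fun t => mul_div_cancel_left₀ _ hc.ne'

end IsGradientBanditRun

end GradientBanditRun

section TwoArms

variable (η : ℝ) (θ₁ : Fin 2 → ℝ) (act : ℕ → Fin 2) (rew : ℕ → ℝ)

theorem gradientBanditParam_one_eq_sub (t : ℕ) :
    gradientBanditParam η θ₁ act rew t 1 = θ₁ 0 + θ₁ 1 - gradientBanditParam η θ₁ act rew t 0 := by
  rw [eq_sub_iff_add_eq', ← Fin.sum_univ_two, ← Fin.sum_univ_two, sum_gradientBanditParam]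

theorem softmaxPolicy_gradientBanditParam_zero (t : ℕ) :
    softmaxPolicy (gradientBanditParam η θ₁ act rew t) 0 =
      Real.sigmoid (2 * gradientBanditParam η θ₁ act rew t 0 - (θ₁ 0 + θ₁ 1)) := by
  rw [softmaxPolicy_zero_eq_sigmoid, gradientBanditParam_one_eq_sub]
  congr 1
  ring

theorem IsGradientBanditRun.ae_tendsto_gradientBanditParam_zero_atTop {Ω : Type*}
    {m : MeasurableSpace Ω} {P : Measure Ω} [IsFiniteMeasure P] {B : StochasticBandit 2} {η : ℝ}
    {θ₁ : Ω → Fin 2 → ℝ} {act : ℕ → Ω → Fin 2} {rew : ℕ → Ω → ℝ}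
    (hrun : IsGradientBanditRun P B η θ₁ act rew) (hη : 0 < η)
    (hB : B.meanReward 1 < B.meanReward 0) :
    ∀ᵐ ω ∂P, Tendsto (fun t => gradientBanditParam η (θ₁ ω) (act · ω) (rew · ω) t 0)
      atTop atTop := by
  have hgap (b : Fin 2) (hb : b ≠ 0) :
      B.meanReward b + (B.meanReward 0 - B.meanReward 1) ≤ B.meanReward 0 := by
    rw [Fin.eq_one_of_ne_zero b hb, add_sub_cancel]
  filter_upwards [hrun.ae_tendsto_gradientBanditParam_atTop_or hη (sub_pos.2 hB) hgap] with ω hω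
  refine hω.resolve_right fun ⟨⟨l, hl⟩, hvanish⟩ => ?_
  have hpolicy : Tendsto (fun t => softmaxPolicy
      (gradientBanditParam η (θ₁ ω) (act · ω) (rew · ω) t) 0)
      atTop (𝓝 (Real.sigmoid (2 * l - (θ₁ ω 0 + θ₁ ω 1)))) := by
    simp only [softmaxPolicy_gradientBanditParam_zero]
    exact (continuous_sigmoid.tendsto _).comp ((hl.const_mul 2).sub_const _)
  exact (mul_pos (Real.sigmoid_pos _) (sub_pos.2 (Real.sigmoid_lt_one _))).ne'
    (tendsto_nhds_unique (hpolicy.mul (hpolicy.const_sub 1)) hvanish)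

end TwoArms

theorem theorem1 {Ω : Type*} [MeasurableSpace Ω] (P : Measure Ω) [IsProbabilityMeasure P]
    (B : StochasticBandit 2) (hB : B.meanReward 1 < B.meanReward 0)
    (η : ℝ) (hη : 0 < η)
    (θ₁ : Ω → Fin 2 → ℝ) (act : ℕ → Ω → Fin 2) (rew : ℕ → Ω → ℝ)
    (hrun : IsGradientBanditRun P B η θ₁ act rew) :
    ∀ᵐ ω ∂P,
      Tendsto (fun t => softmaxPolicy
        (gradientBanditParam η (θ₁ ω) (act · ω) (rew · ω) t) 0) atTop (𝓝 1) ∧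
      Tendsto (fun t => gradientBanditParam η (θ₁ ω) (act · ω) (rew · ω) t 0) atTop atTop ∧
      Tendsto (fun t => gradientBanditParam η (θ₁ ω) (act · ω) (rew · ω) t 1) atTop atBot := by
  filter_upwards [hrun.ae_tendsto_gradientBanditParam_zero_atTop hη hB] with ω hω
  refine ⟨?_, hω, ?_⟩
  · simp only [softmaxPolicy_gradientBanditParam_zero]
    exact Real.tendsto_sigmoid_atTop.comp
      (tendsto_atTop_add_const_right _ _ (hω.const_mul_atTop two_pos))
  · simp only [gradientBanditParam_one_eq_sub, sub_eq_add_neg]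
    exact tendsto_atBot_add_const_left _ _ (tendsto_neg_atTop_atBot.comp hω)
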